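/- Let $G$ be a complex algebraic group (a group scheme of finite type over $\mathbf{C}$, identified with its group $G(\mathbf{C})$ of complex points), and let $P$ and $Q$ be algebraic subgroups of $G$, that is, Zariski closed subgroups of $G(\mathbf{C})$. Put $R = P\cap Q$ and suppose that the quotient space $P/R$ is compact in the usual (complex analytic) topology. Then the set $$PQP=\{\,p\,q\,p' : p,p'\in P,\ q\in Q\,\}$$ is an algebraic subvariety of $G$, i.e. it is Zariski closed in $G(\mathbf{C})$. -/

import Mathlib

open AlgebraicGeometry CategoryTheory

noncomputable section

namespace ComplexAlgGroup

/-- The set `X(ℂ)` of complex points of a scheme `X` over `ℂ`: the sections `Spec ℂ ⟶ X` of the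
structure morphism. -/
def Points (X : Over (Spec (.of ℂ))) : Type :=
  Over.mk (𝟙 (Spec (.of ℂ))) ⟶ X

/-- The complex points of a group scheme over `ℂ` form a group, under the pointwise operations
`x * y = (x, y) ≫ μ`, `1 = η`, `x⁻¹ = x ≫ ι`. -/
instance (G : Over (Spec (.of ℂ))) [GrpObj G] : Group (Points G) :=
  Hom.group (G := G) (X := Over.mk (𝟙 (Spec (.of ℂ))))

/-- The morphism of schemes `Spec ℂ ⟶ X` underlying a complex point of `X`. -/
def Points.toHom {X : Over (Spec (.of ℂ))} (x : Points X) : Spec (.of ℂ) ⟶ X.left :=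
  CommaMorphism.left x

/-- The point of the underlying topological space of `X` at which a complex point is located. -/
def Points.support {X : Over (Spec (.of ℂ))} (x : Points X) : X.left :=
  x.toHom (IsLocalRing.closedPoint ℂ)

lemma Points.top_le_preimage {X : Over (Spec (.of ℂ))} (x : Points X) {U : X.left.Opens}
    (hx : x.support ∈ U) :
    (⊤ : (Spec (.of ℂ)).Opens) ≤ x.toHom ⁻¹ᵁ U := by
  intro y _
  obtain rfl : y = IsLocalRing.closedPoint ℂ := PrimeSpectrum.instUnique.uniq y |>.trans
    (PrimeSpectrum.instUnique.uniq (IsLocalRing.closedPoint ℂ)).symm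
  exact hx

/-- The value `f(x) ∈ ℂ` of a regular function `f` on a Zariski open set `U` at a complex point
`x` of `U`: the pull-back of `f` along `x : Spec ℂ ⟶ U`. -/
def Points.eval {X : Over (Spec (.of ℂ))} (x : Points X) {U : X.left.Opens}
    (hx : x.support ∈ U) (f : Γ(X.left, U)) : ℂ :=
  (Scheme.ΓSpecIso (.of ℂ)).hom
    (x.toHom.appLE U ⊤ (x.top_le_preimage hx) f)

/-- The usual (analytic, Euclidean) topology on `X(ℂ)`: the coarsest topology in which the set of
complex points of every Zariski open `U ⊆ X` is open and every regular function
`f : U(ℂ) → ℂ` is continuous. -/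
instance (X : Over (Spec (.of ℂ))) : TopologicalSpace (Points X) :=
  TopologicalSpace.generateFrom
    {S | ∃ (U : X.left.Opens) (f : Γ(X.left, U)) (V : Set ℂ), IsOpen V ∧
      S = {x | ∃ hx : x.support ∈ U, x.eval hx f ∈ V}}

/-- A set of complex points is Zariski closed if it is the set of all complex points lying on a
closed subset of the scheme. -/
def IsZariskiClosed {X : Over (Spec (.of ℂ))} (S : Set (Points X)) : Prop :=
  ∃ Z : Set X.left, IsClosed Z ∧ S = {x | x.support ∈ Z}

end ComplexAlgGroup

end

open ComplexAlgGroup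

/-!
The set `PQP` is closed for the usual topology: since `P / R` is compact, `PQP` is the image, under
a projection with compact fibre `P / R × P / R`, of the closed set of all `(p, p', x)` with
`p⁻¹ x p' ∈ Q` (`Subgroup.isClosed_mul_mul_of_compactSpace_quotient`). This uses that `G(ℂ)` is a
topological group, whose substance is the continuity of `X(ℂ) × Y(ℂ) → (X × Y)(ℂ)`
(`Points.continuous_pair`); the latter holds because the usual topology on the complex points of
`Spec A` is that of pointwise convergence of characters `A → ℂ` (`Points.tendsto_ofAlgHom`).

By Chevalley's theorem, `PQP` is also the set of complex points of a constructible subset `S` of the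
scheme `G`, namely of the image of a closed subset of `G × G × G` under `(x, y, z) ↦ xyz`
(`Points.image_map_eq`).

It remains to see that `S(ℂ)` is Zariski closed as soon as it is closed for the usual topology
(`isZariskiClosed_of_isConstructible`). Through every point `x` of the Zariski closure of `S` there
is an affine irreducible locally closed set, with coordinate ring `A` say, and a nonzero `f ∈ A`
such that `S` contains the locus `f ≠ 0`. Hence it is enough that `x` is a limit, for the usual
topology, of points where `f ≠ 0` (`exists_tendsto_algHom_ne_zero`). By Noether normalization, `A`
is finite over a polynomial ring `R`. Let `a` be the image of `x` in affine space, and let `a t` tend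
to `a` along a line on which some nonzero multiple `h ∈ R` of `f` does not vanish identically. Choose
`g ∈ A` which vanishes at `x` but at no other point over `a`. The constant coefficient of the minimal
polynomial of `g` over `R` vanishes at `a`, so its specialization at `a t` has a root which tends
to `0`, and as `R` is integrally closed there is a point `y t` over `a t` where `g` takes this value.
The coordinates of `y t` are bounded, being integral over `R`, and any limit point lies over `a` and
is a zero of `g`, so it is `x`.
-/

/-! ### Characters of complex algebras of finite type -/

/-- A nonconstant monic complex polynomial has a root which is small when the constant coefficient
is, since the latter is, up to sign, the product of the roots. -/
lemma Polynomial.exists_isRoot_norm_pow_le {p : Polynomial ℂ} (hp : p.Monic)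
    (hd : p.natDegree ≠ 0) : ∃ c, p.IsRoot c ∧ ‖c‖ ^ p.natDegree ≤ ‖p.coeff 0‖ := by
  have hs : p.Splits := IsAlgClosed.splits p
  have hcard : p.roots.card = p.natDegree := hs.natDegree_eq_card_roots.symm
  have hne : p.roots.toFinset.Nonempty := by
    rw [Multiset.toFinset_nonempty]
    rintro h
    exact hd (by rw [← hcard, h, Multiset.card_zero])
  obtain ⟨c, hc, hmin⟩ := p.roots.toFinset.exists_min_image (fun z => ‖z‖) hne
  have key : ∀ s : Multiset ℂ, (∀ z ∈ s, ‖c‖ ≤ ‖z‖) → ‖c‖ ^ s.card ≤ ‖s.prod‖ := by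
    intro s
    induction s using Multiset.induction with
    | empty => simp
    | cons a s ih =>
      intro h
      rw [Multiset.card_cons, Multiset.prod_cons, norm_mul, pow_succ']
      exact mul_le_mul (h a (Multiset.mem_cons_self a s))
        (ih fun z hz => h z (Multiset.mem_cons_of_mem hz)) (by positivity) (norm_nonneg _)
  refine ⟨c, (Polynomial.mem_roots'.1 (Multiset.mem_toFinset.1 hc)).2, ?_⟩
  rw [hs.coeff_zero_eq_prod_roots_of_monic hp, norm_mul, norm_pow, norm_neg, norm_one, one_pow,
    one_mul, ← hcard]
  exact key _ fun z hz => hmin z (Multiset.mem_toFinset.2 hz)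

lemma Polynomial.norm_le_of_isRoot_of_monic {p : Polynomial ℂ} (hp : p.Monic) {c : ℂ}
    (hc : p.IsRoot c) : ‖c‖ ≤ ∑ i ∈ Finset.range p.natDegree, ‖p.coeff i‖ + 1 := by
  have h : ‖c‖₊ ≤ ∑ i ∈ Finset.range p.natDegree, ‖p.coeff i‖₊ + 1 := by
    refine (Polynomial.IsRoot.norm_lt_cauchyBound hp.ne_zero hc).le.trans ?_
    rw [Polynomial.cauchyBound, hp.leadingCoeff, nnnorm_one, div_one]
    gcongr
    exact Finset.sup_le fun i hi =>
      Finset.single_le_sum (f := fun i => ‖p.coeff i‖₊) (fun _ _ => zero_le) hi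
  rw [← NNReal.coe_le_coe] at h
  simpa using h

section Algebra

variable {A : Type*} [CommRing A] [Algebra ℂ A]

lemma AlgHom.eq_of_ker_le_ker {x y : A →ₐ[ℂ] ℂ} (h : RingHom.ker x ≤ RingHom.ker y) : x = y := by
  ext b
  have : b - algebraMap ℂ A (x b) ∈ RingHom.ker y := h (by simp [RingHom.mem_ker])
  rw [RingHom.mem_ker, map_sub, sub_eq_zero, AlgHom.commutes] at this
  exact this.symm

lemma AlgHom.isMaximal_ker_complex (x : A →ₐ[ℂ] ℂ) : (RingHom.ker x).IsMaximal :=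
  RingHom.ker_isMaximal_of_surjective x fun z => ⟨algebraMap ℂ A z, x.commutes z⟩

/-- **Nullstellensatz**: a maximal ideal of a complex algebra of finite type is the kernel of a
character. -/
lemma Ideal.IsMaximal.exists_algHom_ker_eq [Algebra.FiniteType ℂ A] {N : Ideal A}
    (hN : N.IsMaximal) : ∃ y : A →ₐ[ℂ] ℂ, RingHom.ker y = N := by
  let _ : Field (A ⧸ N) := Ideal.Quotient.field N
  have : Module.Finite ℂ (A ⧸ N) := finite_of_finite_type_of_isJacobsonRing ℂ (A ⧸ N)
  have hb : Function.Bijective (Algebra.ofId ℂ (A ⧸ N)) :=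
    IsAlgClosed.algebraMap_bijective_of_isIntegral
  let e : ℂ ≃ₐ[ℂ] A ⧸ N := AlgEquiv.ofBijective _ hb
  refine ⟨e.symm.toAlgHom.comp (Ideal.Quotient.mkₐ ℂ N), ?_⟩
  ext b
  rw [RingHom.mem_ker]
  change e.symm (Ideal.Quotient.mk N b) = 0 ↔ _
  rw [EmbeddingLike.map_eq_zero_iff, Ideal.Quotient.eq_zero_iff_mem]

variable {R : Type*} [CommRing R] [Algebra R A]

/-- Over an integrally closed domain `R`, the subalgebra `R[g]` is `R[X] / (minpoly R g)`; so, by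
lying over, a character `a` of `R` extends to the integral extension `A` with any prescribed value
at `g` that is a root of the specialization at `a` of the minimal polynomial of `g`. -/
lemma exists_algHom_extends_of_isRoot_minpoly [Algebra ℂ R] [IsScalarTower ℂ R A] [IsDomain R]
    [IsIntegrallyClosed R] [IsDomain A]
    [Module.IsTorsionFree R A] [Algebra.IsIntegral R A] [Algebra.FiniteType ℂ A]
    (a : R →ₐ[ℂ] ℂ) (g : A) (c : ℂ) (hc : ((minpoly R g).map (a : R →+* ℂ)).IsRoot c) :
    ∃ y : A →ₐ[ℂ] ℂ, (∀ r, y (algebraMap R A r) = a r) ∧ y g = c := by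
  let ev : Polynomial R →+* ℂ := Polynomial.eval₂RingHom (a : R →+* ℂ) c
  have hev : Function.Surjective ev := fun z =>
    ⟨Polynomial.C (algebraMap ℂ R z), by simp [ev]⟩
  have hM : (RingHom.ker ev).IsMaximal := RingHom.ker_isMaximal_of_surjective ev hev
  let ψ : Polynomial R →ₐ[R] A := Polynomial.aeval g
  algebraize [ψ.toRingHom]
  have hint : Algebra.IsIntegral (Polynomial R) A := by
    exact Algebra.IsIntegral.tower_top (R := R)
  have hker : RingHom.ker (algebraMap (Polynomial R) A) ≤ RingHom.ker ev := by
    intro p hp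
    obtain ⟨q, rfl⟩ := minpoly.isIntegrallyClosed_dvd (Algebra.IsIntegral.isIntegral (R := R) g) hp
    have h0 : ev (minpoly R g) = 0 := by
      rwa [Polynomial.IsRoot, Polynomial.eval_map] at hc
    rw [RingHom.mem_ker, map_mul, h0, zero_mul]
  obtain ⟨N, hN, hNM⟩ := Ideal.exists_ideal_over_maximal_of_isIntegral (RingHom.ker ev) hker
  obtain ⟨y, hy⟩ := hN.exists_algHom_ker_eq
  have key (p : Polynomial R) : y (ψ p) = ev p := by
    have : p - Polynomial.C (algebraMap ℂ R (ev p)) ∈ RingHom.ker ev := by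
      rw [RingHom.mem_ker]; simp [ev]
    rw [← hNM, ← hy, Ideal.mem_comap, RingHom.mem_ker] at this
    change y (ψ _) = 0 at this
    rw [map_sub, map_sub, sub_eq_zero] at this
    rw [this]
    simp [ψ, ← IsScalarTower.algebraMap_apply]
  refine ⟨y, fun r => ?_, ?_⟩
  · simpa [ψ, ev] using key (Polynomial.C r)
  · simpa [ψ, ev] using key Polynomial.X

/-- An element of `A` which distinguishes a character from the finitely many others with the same
restriction to `R`. -/
lemma exists_separating_element [Module.Finite R A] (x : A →ₐ[ℂ] ℂ) :
    ∃ g : A, x g = 0 ∧ ∀ y : A →ₐ[ℂ] ℂ,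
      (∀ r, y (algebraMap R A r) = x (algebraMap R A r)) → y g = 0 → y = x := by
  classical
  let p : Ideal R := (RingHom.ker x).comap (algebraMap R A)
  have hfin : (p.primesOver A).Finite := Algebra.QuasiFinite.finite_primesOver p
  let S : Finset (Ideal A) := hfin.toFinset.erase (RingHom.ker x)
  have hmax (q : Ideal A) (hq : q ∈ p.primesOver A) : q.IsMaximal := by
    have := hq.1
    have hx := x.isMaximal_ker_complex
    refine Ideal.isMaximal_of_isIntegral_of_isMaximal_comap (R := R) q ?_
    have : q.comap (algebraMap R A) = p := hq.2.over.symm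
    rw [this]
    exact Ideal.isMaximal_comap_of_isIntegral_of_isMaximal (R := R) (RingHom.ker x)
  -- Prime avoidance: the kernel of `x` is not covered by the other maximal ideals over `p`.
  have hnot : ¬ ((RingHom.ker x : Set A) ⊆ ⋃ q ∈ (S : Set (Ideal A)), (q : Set A)) := by
    intro h
    obtain ⟨q, hq, hle⟩ := (Ideal.subset_union_prime (s := S) (f := id) ⊥ ⊥
      (fun q hq _ _ => (hfin.mem_toFinset.1 (Finset.mem_of_mem_erase hq)).1)).1 h
    have hqm := hmax q (hfin.mem_toFinset.1 (Finset.mem_of_mem_erase hq))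
    exact Finset.ne_of_mem_erase hq
      (x.isMaximal_ker_complex.eq_of_le hqm.ne_top hle).symm
  obtain ⟨g, hg, hgS⟩ := Set.not_subset.1 hnot
  refine ⟨g, hg, fun y hy hyg => ?_⟩
  by_contra hne
  refine hgS (Set.mem_iUnion₂.2 ⟨RingHom.ker y, ?_, hyg⟩)
  refine Finset.mem_coe.2 (Finset.mem_erase.2 ⟨fun h => hne (AlgHom.eq_of_ker_le_ker h.le), ?_⟩)
  rw [Set.Finite.mem_toFinset]
  refine ⟨y.isMaximal_ker_complex.isPrime, ⟨?_⟩⟩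
  ext r
  simp [p, RingHom.mem_ker, hy]

end Algebra

/-! ### Approximation of points of an irreducible affine variety -/

open Filter Topology in
/-- A limit of characters which are bounded at every element exists along an ultrafilter. -/
lemma exists_tendsto_algHom_of_isBounded {A ι : Type*} [CommRing A] [Algebra ℂ A]
    (𝒰 : Ultrafilter ι) (y : ι → A →ₐ[ℂ] ℂ) (hb : ∀ b, ∃ M : ℝ, ∀ᶠ s in 𝒰, ‖y s b‖ ≤ M) :
    ∃ z : A →ₐ[ℂ] ℂ, ∀ b, Tendsto (fun s => y s b) 𝒰 (𝓝 (z b)) := by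
  have hlim (b : A) : ∃ w : ℂ, Tendsto (fun s => y s b) 𝒰 (𝓝 w) := by
    obtain ⟨M, hM⟩ := hb b
    obtain ⟨w, -, hw⟩ := (isCompact_closedBall (0 : ℂ) M).ultrafilter_le_nhds
      (𝒰.map fun s => y s b) (by
        rw [le_principal_iff]
        exact hM.mono fun s hs => by simpa using hs)
    exact ⟨w, hw⟩
  choose w hw using hlim
  refine ⟨
    { toFun := w
      map_one' := tendsto_nhds_unique (hw 1) (by simp)
      map_mul' := fun b c => tendsto_nhds_unique (hw _) (by simpa using (hw b).mul (hw c))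
      map_zero' := tendsto_nhds_unique (hw 0) (by simp)
      map_add' := fun b c => tendsto_nhds_unique (hw _) (by simpa using (hw b).add (hw c))
      commutes' := fun c => tendsto_nhds_unique (hw _) (by simp) }, hw⟩

open Filter Topology in
/-- On an affine irreducible complex variety, every point is a limit, for the usual topology, of
points where a given nonzero function does not vanish. -/
theorem exists_tendsto_algHom_ne_zero {A : Type*} [CommRing A] [IsDomain A] [Algebra ℂ A]
    [Algebra.FiniteType ℂ A] {f : A} (hf : f ≠ 0) (x : A →ₐ[ℂ] ℂ) :
    ∃ (𝒰 : Ultrafilter ℂ) (y : ℂ → A →ₐ[ℂ] ℂ), (∀ᶠ s in 𝒰, y s f ≠ 0) ∧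
      ∀ b, Tendsto (fun s => y s b) 𝒰 (𝓝 (x b)) := by
  obtain ⟨n, φ, hinj, hfin⟩ := exists_finite_inj_algHom_of_fg ℂ A
  let R := MvPolynomial (Fin n) ℂ
  let _ : Algebra R A := φ.toRingHom.toAlgebra
  have : IsScalarTower ℂ R A := IsScalarTower.of_algebraMap_eq fun z => (φ.commutes z).symm
  have : Module.Finite R A := hfin
  have : FaithfulSMul R A := (faithfulSMul_iff_algebraMap_injective R A).2 hinj
  have : Module.IsTorsionFree R A := inferInstance
  -- `h` is a nonzero polynomial in the ideal generated by `f`.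
  obtain ⟨h, hh0, hh⟩ : ∃ h : R, h ≠ 0 ∧ ∀ y : A →ₐ[ℂ] ℂ, y f = 0 → y (algebraMap R A h) = 0 := by
    have hne : (Ideal.span {f}).comap (algebraMap R A) ≠ ⊥ :=
      Ideal.comap_ne_bot_of_integral_mem hf (Ideal.mem_span_singleton_self f)
        (Algebra.IsIntegral.isIntegral f)
    obtain ⟨h, hmem, h0⟩ := Submodule.exists_mem_ne_zero_of_ne_bot hne
    refine ⟨h, h0, fun y hy => ?_⟩
    obtain ⟨k, hk⟩ := Ideal.mem_span_singleton.1 (Ideal.mem_comap.1 hmem)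
    rw [hk, map_mul, hy, zero_mul]
  obtain ⟨β, hβ⟩ : ∃ β : Fin n → ℂ, MvPolynomial.eval β h ≠ 0 := by
    by_contra! H
    exact hh0 (MvPolynomial.funext fun β => by simpa using H β)
  -- The characters `a t` of `R` move along the line from the image of `x` to a point where `h`
  -- does not vanish.
  let α : Fin n → ℂ := fun i => x (algebraMap R A (MvPolynomial.X i))
  let line : R →ₐ[ℂ] Polynomial ℂ := MvPolynomial.aeval fun i =>
    Polynomial.C (α i) + Polynomial.X * Polynomial.C (β i - α i)
  let a : ℂ → R →ₐ[ℂ] ℂ := fun t => (Polynomial.aeval t).comp line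
  have ha (t : ℂ) (r : R) : a t r = (line r).eval t := by
    simp [a, Polynomial.coe_aeval_eq_eval]
  have hacont (r : R) : Continuous fun t => a t r := by
    simp only [ha]; exact (line r).continuous
  have ha0 (r : R) : a 0 r = x (algebraMap R A r) := by
    have : a 0 = (x.comp (IsScalarTower.toAlgHom ℂ R A)) := by
      ext i
      simp [a, line, α]
      rfl
    rw [this]; rfl
  have ha1 : a 1 = MvPolynomial.aeval β := by
    ext i
    simp [a, line]
  have hline : line h ≠ 0 := by
    intro H
    apply hβ
    have := ha 1 h
    rw [H, Polynomial.eval_zero, ha1] at this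
    rwa [← MvPolynomial.coe_aeval_eq_eval]
  have hne : ∀ᶠ t in 𝓝[≠] (0 : ℂ), a t h ≠ 0 := by
    have hfinite := Polynomial.finite_setOfPred_isRoot hline
    have := (hfinite.subset (Set.sdiff_subset (t := {0}))).isClosed.isOpen_compl.mem_nhds
      (x := (0 : ℂ)) (by simp)
    filter_upwards [nhdsWithin_le_nhds this, self_mem_nhdsWithin] with t ht ht0 H
    exact ht ⟨(ha t h).symm.trans H, ht0⟩
  obtain ⟨g, hxg, hsep⟩ := exists_separating_element (R := R) x
  have hgint : IsIntegral R g := Algebra.IsIntegral.isIntegral g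
  let F := minpoly R g
  have hF : F.Monic := minpoly.monic hgint
  have hmap (t : ℂ) : (F.map (a t : R →+* ℂ)).natDegree = F.natDegree := hF.natDegree_map _
  have hdeg : F.natDegree ≠ 0 := (minpoly.natDegree_pos hgint).ne'
  have hroot (t : ℂ) := Polynomial.exists_isRoot_norm_pow_le (hF.map (a t : R →+* ℂ))
    (by rw [hmap]; exact hdeg)
  choose c hc hcle using hroot
  have hext (t : ℂ) := exists_algHom_extends_of_isRoot_minpoly (a t) g (c t) (hc t)
  choose y hya hyg using hext
  -- The constant coefficient of `F` vanishes at `a 0` since `x g = 0`.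
  have hc0 : Tendsto c (𝓝 0) (𝓝 0) := by
    have h0 : a 0 (F.coeff 0) = 0 := by
      have h1 : x (Polynomial.aeval g F) = 0 := by rw [minpoly.aeval, map_zero]
      rw [Polynomial.aeval_def, Polynomial.eval₂_eq_sum_range, map_sum,
        Finset.sum_eq_single_of_mem 0 (by simp)] at h1
      · rw [ha0]; simpa using h1
      · intro i _ hi
        rw [map_mul, map_pow, hxg, zero_pow hi, mul_zero]
    have h2 : Tendsto (fun t => ‖a t (F.coeff 0)‖) (𝓝 0) (𝓝 0) := by
      have := (hacont (F.coeff 0)).norm.tendsto 0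
      rwa [h0, norm_zero] at this
    have h3 : Tendsto (fun t => ‖c t‖ ^ F.natDegree) (𝓝 0) (𝓝 0) :=
      squeeze_zero (fun t => by positivity) (fun t => by simpa [hmap] using hcle t) h2
    rw [tendsto_zero_iff_norm_tendsto_zero]
    rw [Metric.tendsto_nhds] at h3 ⊢
    intro ε hε
    filter_upwards [h3 (ε ^ F.natDegree) (by positivity)] with t ht
    simp only [dist_zero_right, norm_pow, norm_norm] at ht ⊢
    exact lt_of_pow_lt_pow_left₀ _ hε.le ht
  -- `y t b` is a root of a monic polynomial whose coefficients are continuous in `t`.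
  have hbdd (b : A) : ∃ M : ℝ, ∀ᶠ t in 𝓝[≠] (0 : ℂ), ‖y t b‖ ≤ M := by
    have hbint : IsIntegral R b := Algebra.IsIntegral.isIntegral b
    let B := minpoly R b
    have hB : B.Monic := minpoly.monic hbint
    let bound : ℂ → ℝ := fun t => ∑ i ∈ Finset.range B.natDegree, ‖a t (B.coeff i)‖ + 1
    have hcont : Continuous bound :=
      (continuous_finsetSum _ fun i _ => (hacont (B.coeff i)).norm).add continuous_const
    refine ⟨bound 0 + 1, ?_⟩
    have := (hcont.tendsto 0).eventually (gt_mem_nhds (lt_add_one (bound 0)))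
    filter_upwards [nhdsWithin_le_nhds this] with t ht
    refine le_trans ?_ ht.le
    have hyroot : (B.map (a t : R →+* ℂ)).IsRoot (y t b) := by
      have h1 : y t (Polynomial.aeval b B) = 0 := by rw [minpoly.aeval, map_zero]
      have h2 : (y t : A →+* ℂ).comp (algebraMap R A) = a t := RingHom.ext (hya t)
      rw [Polynomial.IsRoot, Polynomial.eval_map, ← h1, ← h2]
      exact (Polynomial.hom_eval₂ _ _ (y t : A →+* ℂ) _).symm
    have := Polynomial.norm_le_of_isRoot_of_monic (hB.map _) hyroot
    simpa [hB.natDegree_map, bound] using this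
  -- Any limit of the `y t` lies over `x` and kills `g`, so it is `x`.
  let 𝒰 : Ultrafilter ℂ := Ultrafilter.of (𝓝[≠] 0)
  have h𝒰 : (𝒰 : Filter ℂ) ≤ 𝓝[≠] 0 := Ultrafilter.of_le _
  obtain ⟨z, hz⟩ := exists_tendsto_algHom_of_isBounded 𝒰 y fun b =>
    (hbdd b).imp fun M hM => hM.filter_mono h𝒰
  have hzx : z = x := by
    refine hsep z (fun r => ?_) ?_
    · refine tendsto_nhds_unique (hz _) ?_
      simp only [hya, ← ha0]
      exact ((hacont r).tendsto 0).mono_left (h𝒰.trans nhdsWithin_le_nhds)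
    · refine tendsto_nhds_unique (hz _) ?_
      simp only [hyg]
      exact hc0.mono_left (h𝒰.trans nhdsWithin_le_nhds)
  refine ⟨𝒰, y, ?_, hzx ▸ hz⟩
  filter_upwards [h𝒰 hne] with t ht H
  exact ht (by rw [← hya]; exact hh _ H)

namespace ComplexAlgGroup

open Filter Topology

noncomputable section

/-! ### The usual topology on complex points -/

section Functoriality

variable {X Y : Over (Spec (.of ℂ))}

/-- The map `X(ℂ) → Y(ℂ)` induced by a morphism `φ : X ⟶ Y` of schemes over `ℂ`. -/
def Points.map (φ : X ⟶ Y) (x : Points X) : Points Y :=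
  CategoryStruct.comp (obj := Over (Spec (.of ℂ))) x φ

lemma Points.map_support (φ : X ⟶ Y) (x : Points X) : (x.map φ).support = φ.left x.support := by
  exact Scheme.Hom.comp_apply x.toHom φ.left _

lemma Points.map_eval (φ : X ⟶ Y) (x : Points X) {U : Y.left.Opens}
    (hx : (x.map φ).support ∈ U) (f : Γ(Y.left, U)) :
    (x.map φ).eval hx f = x.eval (U := φ.left ⁻¹ᵁ U)
      (by rw [Points.map_support] at hx; exact hx) (φ.left.app U f) := by
  unfold Points.eval
  congr 1

lemma Points.continuous_map (φ : X ⟶ Y) : Continuous (Points.map φ) := by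
  refine continuous_generateFrom_iff.2 ?_
  rintro _ ⟨U, f, V, hV, rfl⟩
  refine TopologicalSpace.isOpen_generateFrom_of_mem ⟨φ.left ⁻¹ᵁ U, φ.left.app U f, V, hV, ?_⟩
  ext x
  constructor
  · rintro ⟨hx, h⟩
    rw [Points.map_eval] at h
    exact ⟨_, h⟩
  · rintro ⟨hx, h⟩
    have hx' : (x.map φ).support ∈ U := by rw [Points.map_support]; exact hx
    refine ⟨hx', ?_⟩
    rw [Points.map_eval]
    exact h

/-- Evaluation at a complex point, as a ring homomorphism. -/
def Points.evalHom (x : Points X) {U : X.left.Opens} (hx : x.support ∈ U) : Γ(X.left, U) →+* ℂ :=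
  (x.toHom.appLE U ⊤ (x.top_le_preimage hx) ≫ (Scheme.ΓSpecIso (.of ℂ)).hom).hom

lemma Points.evalHom_apply (x : Points X) {U : X.left.Opens} (hx : x.support ∈ U)
    (f : Γ(X.left, U)) : x.evalHom hx f = x.eval hx f :=
  rfl

lemma Points.eval_restrict (x : Points X) {U W : X.left.Opens} (h : U ≤ W) (hx : x.support ∈ U)
    (f : Γ(X.left, W)) :
    x.eval hx (X.left.presheaf.map (homOfLE h).op f) = x.eval (h hx) f := by
  unfold Points.eval
  congr 1
  exact congr($(Scheme.Hom.map_appLE x.toHom (x.top_le_preimage hx) (homOfLE h).op) f)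

lemma Points.support_mem_basicOpen_iff (x : Points X) {U : X.left.Opens} (hx : x.support ∈ U)
    (f : Γ(X.left, U)) : x.support ∈ X.left.basicOpen f ↔ x.eval hx f ≠ 0 := by
  have h1 : (Spec (.of ℂ)).basicOpen (x.toHom.appLE U ⊤ (x.top_le_preimage hx) f) =
      ⊤ ⊓ x.toHom ⁻¹ᵁ X.left.basicOpen f := Scheme.basicOpen_appLE ..
  rw [top_inf_eq, basicOpen_eq_of_affine'] at h1
  have h2 : x.support ∈ X.left.basicOpen f ↔
    IsLocalRing.closedPoint ℂ ∈ PrimeSpectrum.basicOpen (x.eval hx f) := by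
    erw [h1]
    rfl
  rw [h2]
  change x.eval hx f ∉ IsLocalRing.maximalIdeal ℂ ↔ _
  rw [IsLocalRing.maximalIdeal_eq_bot, Ideal.mem_bot]

/-- Near a complex point of an affine open set, a regular function is a quotient of functions
regular on the whole affine open set. -/
lemma Points.exists_eval_eq_div (x : Points X) {U W : X.left.Opens} (hW : IsAffineOpen W)
    (hxW : x.support ∈ W) (hxU : x.support ∈ U) (f : Γ(X.left, U)) :
    ∃ (d k : Γ(X.left, W)) (n : ℕ), x.eval hxW d ≠ 0 ∧ ∀ (z : Points X) (hz : z.support ∈ W),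
      z.eval hz d ≠ 0 → ∃ hzU : z.support ∈ U, z.eval hzU f = z.eval hz k / z.eval hz d ^ n := by
  obtain ⟨d, hdU, hxd⟩ := hW.exists_basicOpen_le ⟨x.support, hxU⟩ hxW
  have := hW.isLocalization_basicOpen d
  obtain ⟨n, k, hk⟩ := IsLocalization.Away.surj d
    (X.left.presheaf.map (homOfLE hdU).op f : Γ(X.left, X.left.basicOpen d))
  refine ⟨d, k, n, (x.support_mem_basicOpen_iff hxW d).1 hxd, fun z hz hd => ?_⟩
  have hzd := (z.support_mem_basicOpen_iff hz d).2 hd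
  refine ⟨hdU hzd, ?_⟩
  rw [eq_div_iff (pow_ne_zero n hd)]
  have h := congrArg (z.evalHom hzd) hk
  have hres (a : Γ(X.left, W)) : z.evalHom hzd (algebraMap _ _ a) = z.eval hz a :=
    z.eval_restrict (X.left.basicOpen_le d) hzd a
  rw [map_mul, map_pow, hres, hres, Points.evalHom_apply, Points.eval_restrict] at h
  exact h

lemma Points.isOpen_setOf_support_mem (U : X.left.Opens) :
    IsOpen {x : Points X | x.support ∈ U} := by
  refine TopologicalSpace.isOpen_generateFrom_of_mem ⟨U, 0, Set.univ, isOpen_univ, ?_⟩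
  ext x
  simp

lemma IsZariskiClosed.isClosed {S : Set (Points X)} (hS : IsZariskiClosed S) : IsClosed S := by
  obtain ⟨Z, hZ, rfl⟩ := hS
  exact ⟨Points.isOpen_setOf_support_mem ⟨Zᶜ, hZ.isOpen_compl⟩⟩

end Functoriality

/-- The affine scheme `Spec A` over `ℂ` attached to a complex algebra `A`. -/
abbrev specOver (A : Type) [CommRing A] [Algebra ℂ A] : Over (Spec (.of ℂ)) :=
  Over.mk (Spec.map (CommRingCat.ofHom (algebraMap ℂ A)))

section Affine

variable {A : Type} [CommRing A] [Algebra ℂ A]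

/-- The complex point of `Spec A` given by a character `A → ℂ`. -/
def Points.ofAlgHom (y : A →ₐ[ℂ] ℂ) : Points (specOver A) :=
  Over.homMk (Spec.map (CommRingCat.ofHom y.toRingHom)) (by
    change Spec.map _ ≫ Spec.map _ = 𝟙 _
    rw [← Spec.map_comp, ← CommRingCat.ofHom_comp]
    have : y.toRingHom.comp (algebraMap ℂ A) = RingHom.id ℂ := RingHom.ext y.commutes
    rw [this]
    exact Spec.map_id _)

lemma Points.ofAlgHom_surjective :
    Function.Surjective (Points.ofAlgHom : (A →ₐ[ℂ] ℂ) → Points (specOver A)) := by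
  intro x
  obtain ⟨ψ, hψ⟩ := Spec.map_surjective x.toHom
  have hw : x.toHom ≫ Spec.map (CommRingCat.ofHom (algebraMap ℂ A)) = 𝟙 _ := Over.w x
  rw [← hψ, ← Spec.map_comp, ← Spec.map_id] at hw
  have hw' := Spec.map_injective hw
  refine ⟨{ ψ.hom with commutes' := fun c => congr($(hw').hom c) }, ?_⟩
  exact Over.OverMorphism.ext hψ

lemma Points.support_ofAlgHom_asIdeal (y : A →ₐ[ℂ] ℂ) :
    PrimeSpectrum.asIdeal (Points.ofAlgHom y).support = RingHom.ker y := by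
  ext a
  change y a ∈ IsLocalRing.maximalIdeal ℂ ↔ _
  rw [IsLocalRing.maximalIdeal_eq_bot]
  rfl

lemma Points.eval_ofAlgHom (y : A →ₐ[ℂ] ℂ) (a : Γ(Spec (.of A), ⊤)) :
    (Points.ofAlgHom y).eval (U := ⊤) trivial a = y ((Scheme.ΓSpecIso (.of A)).hom a) := by
  let φ : CommRingCat.of A ⟶ CommRingCat.of ℂ := CommRingCat.ofHom y.toRingHom
  change ((Spec.map φ).appLE ⊤ ⊤ _ ≫ (Scheme.ΓSpecIso (.of ℂ)).hom) a =
    ((Scheme.ΓSpecIso (.of A)).hom ≫ φ) a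
  rw [← Scheme.ΓSpecIso_naturality]
  congr 2

/-- A regular function near a point of an affine scheme is a quotient of two global functions, so
the usual topology on the points of `Spec A` is the topology of pointwise convergence of
characters. -/
lemma Points.tendsto_ofAlgHom {ι : Type*} {l : Filter ι} {y : ι → A →ₐ[ℂ] ℂ} {x : A →ₐ[ℂ] ℂ}
    (h : ∀ a, Tendsto (fun s => y s a) l (𝓝 (x a))) :
    Tendsto (fun s => Points.ofAlgHom (y s)) l (𝓝 (Points.ofAlgHom x)) := by
  refine TopologicalSpace.tendsto_nhds_generateFrom_iff.2 ?_
  rintro _ ⟨U, f, V, hV, rfl⟩ ⟨hxU, hxV⟩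
  obtain ⟨d, k, n, hd, hdiv⟩ := (Points.ofAlgHom x).exists_eval_eq_div (W := ⊤)
    (isAffineOpen_top (Spec (.of A))) trivial hxU f
  obtain ⟨_, hx⟩ := hdiv _ trivial hd
  have hT (a : Γ(Spec (.of A), ⊤)) :
      Tendsto (fun s => (Points.ofAlgHom (y s)).eval (U := ⊤) trivial a) l
        (𝓝 ((Points.ofAlgHom x).eval (U := ⊤) trivial a)) := by
    simpa only [Points.eval_ofAlgHom] using h _
  have hquot := (hT k).div ((hT d).pow n) (pow_ne_zero n hd)
  rw [hx] at hxV
  filter_upwards [hquot.eventually (hV.mem_nhds hxV), (hT d).eventually_ne hd] with s hs hsd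
  obtain ⟨hsU, hseq⟩ := hdiv (Points.ofAlgHom (y s)) trivial hsd
  exact ⟨hsU, by rw [hseq]; exact hs⟩

end Affine


/-! ### Open immersions and affine charts -/

section Immersion

variable {X Y : Over (Spec (.of ℂ))}

lemma Points.map_comp {Z : Over (Spec (.of ℂ))} (φ : X ⟶ Y) (ψ : Y ⟶ Z) (x : Points X) :
    x.map (φ ≫ ψ) = (x.map φ).map ψ :=
  (Category.assoc (obj := Over (Spec (.of ℂ))) x φ ψ).symm

lemma Points.exists_map_eq (φ : X ⟶ Y) [IsOpenImmersion φ.left] {y : Points Y}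
    (hy : y.support ∈ Set.range φ.left) : ∃ x : Points X, x.map φ = y := by
  have hr : Set.range y.toHom ⊆ Set.range φ.left := by
    rintro _ ⟨p, rfl⟩
    obtain rfl : p = IsLocalRing.closedPoint ℂ := Subsingleton.elim (α := PrimeSpectrum ℂ) _ _
    exact hy
  have hfac := IsOpenImmersion.lift_fac φ.left y.toHom hr
  refine ⟨Over.homMk (IsOpenImmersion.lift φ.left y.toHom hr) ?_, Over.OverMorphism.ext hfac⟩
  change _ = 𝟙 _
  rw [← Over.w φ, ← Category.assoc, hfac]
  exact Over.w y

lemma Points.range_map (φ : X ⟶ Y) [IsOpenImmersion φ.left] :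
    Set.range (Points.map φ) = {y | y.support ∈ φ.left.opensRange} := by
  ext y
  refine ⟨?_, fun hy => Points.exists_map_eq φ hy⟩
  rintro ⟨x, rfl⟩
  exact ⟨x.support, (x.map_support φ).symm⟩

lemma Points.map_injective (φ : X ⟶ Y) [IsOpenImmersion φ.left] :
    Function.Injective (Points.map φ) := by
  intro x x' h
  have h' : x.toHom ≫ φ.left = x'.toHom ≫ φ.left := congrArg CommaMorphism.left h
  exact Over.OverMorphism.ext ((cancel_mono φ.left).1 h')

lemma Points.isOpenEmbedding_map (φ : X ⟶ Y) [IsOpenImmersion φ.left] :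
    IsOpenEmbedding (Points.map φ) := by
  refine ⟨⟨⟨le_antisymm (Points.continuous_map φ).le_induced ?_⟩, Points.map_injective φ⟩, ?_⟩
  · refine le_generateFrom ?_
    rintro _ ⟨U, f, V, hV, rfl⟩
    refine ⟨_, TopologicalSpace.isOpen_generateFrom_of_mem
      ⟨φ.left ''ᵁ U, (φ.left.appIso U).inv f, V, hV, rfl⟩, ?_⟩
    have hU (x : Points X) : (x.map φ).support ∈ φ.left ''ᵁ U ↔ x.support ∈ U := by
      rw [Points.map_support]
      exact φ.left.isOpenEmbedding.injective.mem_set_image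
    have heval (x : Points X) (hx : x.support ∈ U) :
        (x.map φ).eval ((hU x).2 hx) ((φ.left.appIso U).inv f) = x.eval hx f := by
      rw [Points.map_eval]
      have : φ.left.app (φ.left ''ᵁ U) ((φ.left.appIso U).inv f) =
          X.left.presheaf.map (homOfLE (φ.left.preimage_image_eq U).le).op f := by
        rw [← CommRingCat.comp_apply, Scheme.Hom.appIso_inv_app]
        rfl
      rw [this]
      exact Points.eval_restrict x _ (by rwa [φ.left.preimage_image_eq]) f
    ext x
    constructor
    · rintro ⟨hx, h⟩
      exact ⟨(hU x).1 hx, by rw [← heval]; exact h⟩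
    · rintro ⟨hx, h⟩
      exact ⟨(hU x).2 hx, by rw [heval]; exact h⟩
  · rw [Points.range_map]
    exact Points.isOpen_setOf_support_mem _

lemma exists_affine_chart (X : Over (Spec (.of ℂ))) (p : X.left) :
    ∃ (A : Type) (_ : CommRing A) (_ : Algebra ℂ A) (j : specOver A ⟶ X),
      IsOpenImmersion j.left ∧ p ∈ Set.range j.left := by
  obtain ⟨U, hU, hp, -⟩ := exists_isAffineOpen_mem_and_subset (x := p) (U := ⊤) trivial
  let ψ : CommRingCat.of ℂ ⟶ Γ(X.left, U) := Spec.preimage (hU.fromSpec ≫ X.hom)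
  have hψ : Spec.map ψ = hU.fromSpec ≫ X.hom := Spec.map_preimage _
  let _ : Algebra ℂ Γ(X.left, U) := ψ.hom.toAlgebra
  refine ⟨Γ(X.left, U), inferInstance, inferInstance, Over.homMk hU.fromSpec hψ.symm, ?_, ?_⟩
  · exact inferInstanceAs (IsOpenImmersion hU.fromSpec)
  · exact hU.range_fromSpec.symm ▸ hp

lemma finiteType_of_affine_chart {X : Over (Spec (.of ℂ))} [LocallyOfFiniteType X.hom]
    {A : Type} [CommRing A] [Algebra ℂ A] (j : specOver A ⟶ X) [IsOpenImmersion j.left] :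
    Algebra.FiniteType ℂ A := by
  have h : LocallyOfFiniteType (j.left ≫ X.hom) := inferInstance
  rw [Over.w j] at h
  exact RingHom.finiteType_algebraMap.1
    ((HasRingHomProperty.Spec_iff (P := @LocallyOfFiniteType)).1 h)

end Immersion

/-! ### Products and the topological group of complex points -/

section Product

variable {A B : Type} [CommRing A] [Algebra ℂ A] [CommRing B] [Algebra ℂ B]

/-- The morphism `Spec B ⟶ Spec A` over `ℂ` attached to a homomorphism `A → B`. -/
def specMap (φ : A →ₐ[ℂ] B) : specOver B ⟶ specOver A :=
  Over.homMk (Spec.map (CommRingCat.ofHom φ.toRingHom)) (by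
    change Spec.map _ ≫ Spec.map _ = Spec.map _
    rw [← Spec.map_comp, ← CommRingCat.ofHom_comp]
    congr 2
    exact φ.comp_algebraMap)

lemma Points.map_ofAlgHom (φ : A →ₐ[ℂ] B) (y : B →ₐ[ℂ] ℂ) :
    (Points.ofAlgHom y).map (specMap φ) = Points.ofAlgHom (y.comp φ) := by
  refine Over.OverMorphism.ext ?_
  change Spec.map _ ≫ Spec.map _ = Spec.map _
  rw [← Spec.map_comp, ← CommRingCat.ofHom_comp]
  rfl

/-- The character of `A` given by a complex point of `Spec A`: the preimage of the point under
`Points.ofAlgHom`, unique by `Points.eval_ofAlgHom`. -/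
def Points.toAlgHom (x : Points (specOver A)) : A →ₐ[ℂ] ℂ :=
  Function.surjInv Points.ofAlgHom_surjective x

lemma Points.ofAlgHom_toAlgHom (x : Points (specOver A)) : Points.ofAlgHom x.toAlgHom = x :=
  Function.surjInv_eq Points.ofAlgHom_surjective x

lemma Points.toAlgHom_apply (x : Points (specOver A)) (a : A) :
    x.toAlgHom a = x.eval (U := ⊤) trivial ((Scheme.ΓSpecIso (.of A)).inv a) := by
  conv_rhs => rw [← Points.ofAlgHom_toAlgHom x]
  rw [Points.eval_ofAlgHom, ← CommRingCat.comp_apply, Iso.inv_hom_id]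
  rfl

lemma Points.continuous_toAlgHom_apply (a : A) :
    Continuous fun x : Points (specOver A) => x.toAlgHom a := by
  refine continuous_def.2 fun V hV => ?_
  refine TopologicalSpace.isOpen_generateFrom_of_mem
    ⟨⊤, (Scheme.ΓSpecIso (.of A)).inv a, V, hV, ?_⟩
  ext x
  rw [Set.mem_preimage, Points.toAlgHom_apply]
  exact ⟨fun h => ⟨trivial, h⟩, fun ⟨_, h⟩ => h⟩

open TensorProduct in
lemma Points.continuous_ofAlgHom_tensor :
    Continuous fun z : Points (specOver A) × Points (specOver B) =>
      Points.ofAlgHom (Algebra.TensorProduct.lift z.1.toAlgHom z.2.toAlgHom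
        fun _ _ => Commute.all _ _) := by
  refine continuous_iff_continuousAt.2 fun z => Points.tendsto_ofAlgHom fun t => ?_
  refine Continuous.tendsto (f := fun z : Points (specOver A) × Points (specOver B) =>
    Algebra.TensorProduct.lift z.1.toAlgHom z.2.toAlgHom (fun _ _ => Commute.all _ _) t) ?_ z
  induction t with
  | zero => simpa using continuous_const
  | tmul a b =>
    simp only [Algebra.TensorProduct.lift_tmul]
    exact ((Points.continuous_toAlgHom_apply a).comp continuous_fst).mul
      ((Points.continuous_toAlgHom_apply b).comp continuous_snd)
  | add s t hs ht =>
    simp only [map_add]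
    exact hs.add ht

open CartesianMonoidalCategory MonoidalCategory

variable {X Y : Over (Spec (.of ℂ))}

/-- The complex point of `X ×_ℂ Y` with given components. -/
def Points.pair (x : Points X) (y : Points Y) : Points (X ⊗ Y) :=
  @lift (Over (Spec (.of ℂ))) _ _ (Over.mk (𝟙 _)) X Y x y

lemma Points.map_lift {Z : Over (Spec (.of ℂ))} (φ : Z ⟶ X) (ψ : Z ⟶ Y) (z : Points Z) :
    z.map (lift φ ψ) = (z.map φ).pair (z.map ψ) :=
  @comp_lift (Over (Spec (.of ℂ))) _ _ (Over.mk (𝟙 _)) Z X Y z φ ψ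

lemma Points.map_fst_pair (x : Points X) (y : Points Y) : (x.pair y).map (fst X Y) = x :=
  @lift_fst (Over (Spec (.of ℂ))) _ _ (Over.mk (𝟙 _)) X Y x y

lemma Points.map_snd_pair (x : Points X) (y : Points Y) : (x.pair y).map (snd X Y) = y :=
  @lift_snd (Over (Spec (.of ℂ))) _ _ (Over.mk (𝟙 _)) X Y x y

/-- The bijection `X(ℂ) × Y(ℂ) → (X × Y)(ℂ)` is continuous although open sets of the scheme
`X × Y` are not generated by products: on a product of affine charts, the regular functions are
sums of products of functions of one variable. -/
lemma Points.continuous_pair :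
    Continuous fun z : Points X × Points Y => z.1.pair z.2 := by
  refine continuous_iff_continuousAt.2 fun ⟨x, y⟩ => ?_
  obtain ⟨A, _, _, i, hi, hx⟩ := exists_affine_chart X x.support
  obtain ⟨B, _, _, j, hj, hy⟩ := exists_affine_chart Y y.support
  obtain ⟨x, rfl⟩ := Points.exists_map_eq i hx
  obtain ⟨y, rfl⟩ := Points.exists_map_eq j hy
  have hij := (Points.isOpenEmbedding_map i).prodMap (Points.isOpenEmbedding_map j)
  refine (hij.continuousAt_iff (x := (x, y))).1 (Continuous.continuousAt ?_)
  let k : specOver (TensorProduct ℂ A B) ⟶ X ⊗ Y :=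
    lift (specMap Algebra.TensorProduct.includeLeft ≫ i)
      (specMap Algebra.TensorProduct.includeRight ≫ j)
  refine ((Points.continuous_map k).comp Points.continuous_ofAlgHom_tensor).congr fun z => ?_
  have hright : (Algebra.TensorProduct.lift z.1.toAlgHom z.2.toAlgHom
      fun _ _ => Commute.all _ _).comp Algebra.TensorProduct.includeRight = z.2.toAlgHom := by
    ext b
    simp
  simp only [Function.comp_apply, k, Points.map_lift, Points.map_comp, Points.map_ofAlgHom,
    Algebra.TensorProduct.lift_comp_includeLeft, hright, Points.ofAlgHom_toAlgHom]
  rfl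

instance (G : Over (Spec (.of ℂ))) [GrpObj G] : IsTopologicalGroup (Points G) where
  continuous_mul := (Points.continuous_map MonObj.mul).comp Points.continuous_pair
  continuous_inv := Points.continuous_map GrpObj.inv

end Product

end

end ComplexAlgGroup

/-! ### Constructible sets and their complex points -/

open Topology in
/-- A constructible set contains, for every point `p` of its closure, a dense open subset
`D(f) ∩ V(q)` of an irreducible closed set `V(q)` through `p`. -/
lemma PrimeSpectrum.exists_basicOpen_inter_zeroLocus_subset {A : Type*} [CommRing A]
    {S : Set (PrimeSpectrum A)} (hS : IsConstructible S) {p : PrimeSpectrum A}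
    (hp : p ∈ closure S) :
    ∃ (q : PrimeSpectrum A) (f : A), q ≤ p ∧ f ∉ q.asIdeal ∧
      ∀ r : PrimeSpectrum A, q ≤ r → f ∉ r.asIdeal → r ∈ S := by
  obtain ⟨q, hqS, hqp⟩ : ∃ q ∈ S, q ≤ p := by
    obtain ⟨B, _, φ, rfl⟩ := exists_range_eq_of_isConstructible hS
    rw [closure_range_comap, mem_zeroLocus, SetLike.coe_subset_coe] at hp
    obtain ⟨q, hq, hqp⟩ := Ideal.exists_minimalPrimes_le hp
    obtain ⟨q', hq', -, rfl⟩ := Ideal.exists_comap_eq_of_mem_minimalPrimes (I := ⊥) φ q hq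
    exact ⟨_, ⟨⟨q', hq'⟩, rfl⟩, hqp⟩
  obtain ⟨C, rfl⟩ := exists_constructibleSetData_iff.2 hS
  obtain ⟨D, hD, hqD⟩ := Set.mem_iUnion₂.1 hqS
  refine ⟨q, D.f, hqp, fun h => hqD.2 (by simpa using h), fun r hqr hr => ?_⟩
  refine Set.mem_iUnion₂.2 ⟨D, hD, fun a ha => hqr (hqD.1 ha), fun h => hr (by simpa using h)⟩

namespace ComplexAlgGroup

open Filter Topology

variable {X Y : Over (Spec (.of ℂ))}

/-- A constructible set whose complex points form a closed set for the usual topology has Zariski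
closed set of complex points. -/
theorem isZariskiClosed_of_isConstructible [LocallyOfFiniteType X.hom] {S : Set X.left}
    (hS : IsConstructible S) (hc : IsClosed {x : Points X | x.support ∈ S}) :
    IsZariskiClosed {x : Points X | x.support ∈ S} := by
  refine ⟨closure S, isClosed_closure, Set.Subset.antisymm (fun x hx => subset_closure hx) ?_⟩
  intro x hx
  obtain ⟨A, _, _, j, hj, hxj⟩ := exists_affine_chart X x.support
  have := finiteType_of_affine_chart j
  obtain ⟨x, rfl⟩ := Points.exists_map_eq j hxj
  obtain ⟨u, rfl⟩ := Points.ofAlgHom_surjective x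
  have hp : (Points.ofAlgHom u).support ∈ closure (j.left ⁻¹' S) := by
    rw [← j.left.isOpenEmbedding.isOpenMap.preimage_closure_eq_closure_preimage j.left.continuous]
    rw [Set.mem_preimage, ← Points.map_support]
    exact hx
  obtain ⟨q, f, hqp, hfq, hq⟩ := PrimeSpectrum.exists_basicOpen_inter_zeroLocus_subset
    (A := A) (j.left.isConstructible_preimage hS) hp
  -- `u` is a character of the domain `A ⧸ q`, on which `f` is nonzero.
  have hqu : ∀ a ∈ q.asIdeal, u a = 0 := fun a ha => by
    rw [← RingHom.mem_ker, ← Points.support_ofAlgHom_asIdeal]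
    exact hqp ha
  let v : A ⧸ q.asIdeal →ₐ[ℂ] ℂ := Ideal.Quotient.liftₐ q.asIdeal u hqu
  have hf : Ideal.Quotient.mk q.asIdeal f ≠ 0 := fun h =>
    hfq (Ideal.Quotient.eq_zero_iff_mem.1 h)
  obtain ⟨𝒰, y, hy, hlim⟩ := exists_tendsto_algHom_ne_zero hf v
  have hT : Tendsto (fun s => (Points.ofAlgHom ((y s).comp (Ideal.Quotient.mkₐ ℂ q.asIdeal))).map j)
      𝒰 (𝓝 ((Points.ofAlgHom u).map j)) :=
    ((Points.continuous_map j).tendsto _).comp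
      (Points.tendsto_ofAlgHom fun a => hlim (Ideal.Quotient.mk _ a))
  refine hc.mem_of_tendsto hT ?_
  filter_upwards [hy] with s hs
  rw [Points.map_support]
  refine hq _ ?_ ?_
  · intro a ha
    rw [Points.support_ofAlgHom_asIdeal, RingHom.mem_ker]
    change y s (Ideal.Quotient.mk _ a) = 0
    rw [Ideal.Quotient.eq_zero_iff_mem.2 ha, map_zero]
  · rw [Points.support_ofAlgHom_asIdeal, RingHom.mem_ker]
    exact hs

lemma Points.isClosed_support [LocallyOfFiniteType X.hom] (x : Points X) :
    IsClosed {x.support} :=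
  (pointEquivClosedPoint X.hom ⟨x.toHom, Over.w x⟩).2

lemma Points.support_injective [LocallyOfFiniteType X.hom] :
    Function.Injective (Points.support : Points X → X.left) := fun x y h =>
  Over.OverMorphism.ext (ext_of_apply_closedPoint_eq X.hom (Over.w x) (Over.w y) h)

lemma Points.exists_support_eq [LocallyOfFiniteType X.hom] {p : X.left} (hp : IsClosed {p}) :
    ∃ x : Points X, x.support = p :=
  ⟨Over.homMk (pointOfClosedPoint X.hom p hp) (pointOfClosedPoint_comp X.hom p hp),
    pointOfClosedPoint_apply X.hom p hp _⟩

/-- The image of the complex points of a closed set consists of all complex points of its image: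
the fibres over complex points are schemes of finite type over `ℂ`, so they have closed points. -/
lemma Points.image_map_eq [LocallyOfFiniteType X.hom] [LocallyOfFiniteType Y.hom] (φ : X ⟶ Y)
    {Z : Set X.left} (hZ : IsClosed Z) :
    Points.map φ '' {x | x.support ∈ Z} = {y | y.support ∈ φ.left '' Z} := by
  ext y
  constructor
  · rintro ⟨x, hx, rfl⟩
    exact ⟨x.support, hx, (x.map_support φ).symm⟩
  · rintro ⟨p, hpZ, hp⟩
    have : JacobsonSpace X.left := LocallyOfFiniteType.jacobsonSpace X.hom
    obtain ⟨p', ⟨hp'Z, hp'⟩, hcl⟩ := nonempty_inter_closedPoints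
      (Z := Z ∩ φ.left ⁻¹' {y.support}) ⟨p, hpZ, hp⟩
      (hZ.inter (y.isClosed_support.preimage φ.left.continuous)).isLocallyClosed
    obtain ⟨x, rfl⟩ := Points.exists_support_eq hcl
    exact ⟨x, hp'Z, Points.support_injective ((x.map_support φ).trans hp')⟩

lemma isNoetherian_left (X : Over (Spec (.of ℂ))) [LocallyOfFiniteType X.hom]
    [QuasiCompact X.hom] : IsNoetherian X.left where
  toIsLocallyNoetherian := LocallyOfFiniteType.isLocallyNoetherian X.hom
  toCompactSpace := QuasiCompact.compactSpace_of_compactSpace X.hom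

lemma isConstructible_image_of_isClosed [LocallyOfFiniteType X.hom] [QuasiCompact X.hom]
    [LocallyOfFiniteType Y.hom] [QuasiCompact Y.hom] (φ : X ⟶ Y) {Z : Set X.left}
    (hZ : IsClosed Z) : IsConstructible (φ.left '' Z) := by
  have := isNoetherian_left X
  have := isNoetherian_left Y
  have : LocallyOfFiniteType φ.left := by
    have h : LocallyOfFiniteType (φ.left ≫ Y.hom) := by rw [Over.w φ]; infer_instance
    exact locallyOfFiniteType_of_comp φ.left Y.hom
  refine φ.left.isConstructible_image (IsConstructible.of_compl ?_)
  exact (TopologicalSpace.NoetherianSpace.isCompact Zᶜ).isConstructible hZ.isOpen_compl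

end ComplexAlgGroup

/-! ### Double cosets -/

open Topology in
/-- If `P / (P ⊓ Q)` is compact then `PQP` is closed: it is the projection to `G` of the closed set
of all `(p, p', x)` with `p⁻¹ x p' ∈ Q`, which descends to `P / (P ⊓ Q) × P / (P ⊓ Q) × G`. -/
theorem Subgroup.isClosed_mul_mul_of_compactSpace_quotient {G : Type*} [Group G]
    [TopologicalSpace G] [IsTopologicalGroup G] (P Q : Subgroup G) (hQ : IsClosed (Q : Set G))
    [CompactSpace (P ⧸ (P ⊓ Q).subgroupOf P)] :
    IsClosed {g : G | ∃ p ∈ P, ∃ q ∈ Q, ∃ p' ∈ P, g = p * q * p'} := by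
  let R := (P ⊓ Q).subgroupOf P
  -- The set of all `(p, p', x)` with `p⁻¹ x p' ∈ Q`, modulo `R × R`.
  let E : Set (((P ⧸ R) × (P ⧸ R)) × G) :=
    {z | ∃ p p' : P, ((p : P ⧸ R), (p' : P ⧸ R)) = z.1 ∧ (p : G)⁻¹ * z.2 * p' ∈ Q}
  have hE : IsClosed E := by
    have hπ : IsOpenQuotientMap (QuotientGroup.mk : P → P ⧸ R) :=
      QuotientGroup.isOpenQuotientMap_mk
    have hquot := ((hπ.prodMap hπ).prodMap (IsOpenQuotientMap.id (X := G))).isQuotientMap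
    rw [← hquot.isClosed_preimage]
    have hpre : Prod.map (Prod.map (QuotientGroup.mk : P → P ⧸ R) (QuotientGroup.mk : P → P ⧸ R))
        id ⁻¹' E = (fun z : (P × P) × G => (z.1.1 : G)⁻¹ * z.2 * z.1.2) ⁻¹' (Q : Set G) := by
      ext ⟨⟨p, p'⟩, x⟩
      constructor
      · rintro ⟨s, s', h, hx⟩
        obtain ⟨h1, h2⟩ := Prod.mk.inj h
        have h1' := (Subgroup.mem_subgroupOf.1 (QuotientGroup.eq.1 h1)).2
        have h2' := (Subgroup.mem_subgroupOf.1 (QuotientGroup.eq.1 h2)).2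
        have := Q.mul_mem (Q.mul_mem (Q.inv_mem h1') hx) h2'
        simpa [mul_assoc] using this
      · exact fun hx => ⟨p, p', rfl, hx⟩
    rw [hpre]
    exact hQ.preimage (by fun_prop)
  convert isClosedMap_snd_of_compactSpace (X := (P ⧸ R) × (P ⧸ R)) (Y := G) _ hE using 1
  ext x
  constructor
  · rintro ⟨p, hp, q, hq, p', hp', rfl⟩
    -- The second coordinate is `p'⁻¹`, because `p⁻¹ (p q p') p'⁻¹ = q`.
    refine ⟨(_, p * q * p'), ⟨⟨p, hp⟩, ⟨p', hp'⟩⁻¹, rfl, ?_⟩, rfl⟩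
    simpa [mul_assoc] using hq
  · rintro ⟨⟨_, x⟩, ⟨p, p', -, hx⟩, rfl⟩
    exact ⟨p, p.2, _, hx, (p' : G)⁻¹, P.inv_mem p'.2, by simp [mul_assoc]⟩

open CartesianMonoidalCategory MonoidalCategory Topology in
theorem mainTheorem8 (G : Over (Spec (.of ℂ))) [GrpObj G]
    [LocallyOfFiniteType G.hom] [QuasiCompact G.hom]
    (P Q : Subgroup (Points G))
    (hP : IsZariskiClosed (P : Set (Points G)))
    (hQ : IsZariskiClosed (Q : Set (Points G)))
    (hPR : CompactSpace (↥P ⧸ (P ⊓ Q).subgroupOf P)) :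
    IsZariskiClosed {g : Points G | ∃ p ∈ P, ∃ q ∈ Q, ∃ p' ∈ P, g = p * q * p'} := by
  have hclosed := P.isClosed_mul_mul_of_compactSpace_quotient Q hQ.isClosed
  obtain ⟨ZP, hZP, hP⟩ := hP
  obtain ⟨ZQ, hZQ, hQ⟩ := hQ
  have hmemP (x : Points G) : x ∈ P ↔ x.support ∈ ZP := Set.ext_iff.1 hP x
  have hmemQ (x : Points G) : x ∈ Q ↔ x.support ∈ ZQ := Set.ext_iff.1 hQ x
  let p₁ : (G ⊗ G) ⊗ G ⟶ G := fst _ _ ≫ fst _ _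
  let p₂ : (G ⊗ G) ⊗ G ⟶ G := fst _ _ ≫ snd _ _
  let p₃ : (G ⊗ G) ⊗ G ⟶ G := snd _ _
  let m : (G ⊗ G) ⊗ G ⟶ G := lift (lift p₁ p₂ ≫ MonObj.mul) p₃ ≫ MonObj.mul
  have hm (z : Points ((G ⊗ G) ⊗ G)) : z.map m = z.map p₁ * z.map p₂ * z.map p₃ := by
    simp only [m, Points.map_comp, Points.map_lift]
    rfl
  let Z : Set ((G ⊗ G) ⊗ G).left :=
    p₁.left ⁻¹' ZP ∩ p₂.left ⁻¹' ZQ ∩ p₃.left ⁻¹' ZP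
  have hZ : IsClosed Z :=
    ((hZP.preimage p₁.left.continuous).inter (hZQ.preimage p₂.left.continuous)).inter
      (hZP.preimage p₃.left.continuous)
  have : LocallyOfFiniteType ((G ⊗ G) ⊗ G).hom := by dsimp; infer_instance
  have : QuasiCompact ((G ⊗ G) ⊗ G).hom := by dsimp; infer_instance
  have hset : {g : Points G | ∃ p ∈ P, ∃ q ∈ Q, ∃ p' ∈ P, g = p * q * p'} =
      {g | g.support ∈ m.left '' Z} := by
    rw [← Points.image_map_eq m hZ]
    ext g
    constructor
    · rintro ⟨p, hp, q, hq, p', hp', rfl⟩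
      have h₁ : ((p.pair q).pair p').map p₁ = p := by
        rw [Points.map_comp, Points.map_fst_pair, Points.map_fst_pair]
      have h₂ : ((p.pair q).pair p').map p₂ = q := by
        rw [Points.map_comp, Points.map_fst_pair, Points.map_snd_pair]
      have h₃ : ((p.pair q).pair p').map p₃ = p' := Points.map_snd_pair _ _
      refine ⟨(p.pair q).pair p', ⟨⟨?_, ?_⟩, ?_⟩, by rw [hm, h₁, h₂, h₃]⟩
      · rw [Set.mem_preimage, ← Points.map_support, h₁]; exact (hmemP p).1 hp
      · rw [Set.mem_preimage, ← Points.map_support, h₂]; exact (hmemQ q).1 hq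
      · rw [Set.mem_preimage, ← Points.map_support, h₃]; exact (hmemP p').1 hp'
    · rintro ⟨z, ⟨⟨h1, h2⟩, h3⟩, rfl⟩
      refine ⟨z.map p₁, ?_, z.map p₂, ?_, z.map p₃, ?_, hm z⟩
      · rw [hmemP, Points.map_support]; exact h1
      · rw [hmemQ, Points.map_support]; exact h2
      · rw [hmemP, Points.map_support]; exact h3
  rw [hset] at hclosed ⊢
  exact isZariskiClosed_of_isConstructible (isConstructible_image_of_isClosed m hZ) hclosed
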